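/- Let $F$ be a field of characteristic zero, let $L\neq 0$ be a finite-dimensional Lie algebra over $F$, and let $S$ be a finite-dimensional $L$-module over $F$ that is faithful (only $x=0$ in $L$ satisfies $x\cdot s=0$ for all $s\in S$) and irreducible ($S\neq 0$, and the only $L$-submodules of $S$ are $0$ and $S$). Then $$H^n(L,S)=0\qquad\text{for every integer } n\ge 0.$$ Here $H^n(L,S)$ is the Chevalley–Eilenberg cohomology of $L$ with coefficients in $S$: writing $C^n(L,S)$ for the space of alternating $n$-linear maps $L^n\to S$, $H^n(L,S)=\ker(d\colon C^n\to C^{n+1})/d(C^{n-1})$ (with $C^{-1}=0$), where $$(d\omega)(v_0,\dots,v_n)=\sum_{j=0}^{n}(-1)^j\, v_j\cdot\omega(v_0,\dots,\widehat{v_j},\dots,v_n)+\sum_{0\le i<j\le n}(-1)^{i+j}\,\omega([v_i,v_j],v_0,\dots,\widehat{v_i},\dots,\widehat{v_j},\dots,v_n).$$ -/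

import Mathlib

namespace ChevalleyEilenberg

section Contraction

variable {R L M : Type*} [CommRing R] [LieRing L] [LieAlgebra R L]
  [AddCommGroup M] [Module R M]

/-- The contraction `ι_x ω = ω (x, ·, …, ·)`. -/
def contract {n : ℕ} (x : L) : (L [⋀^Fin (n + 1)]→ₗ[R] M) →ₗ[R] (L [⋀^Fin n]→ₗ[R] M) :=
  AlternatingMap.curryLeftLinearMap.flip x

theorem contract_apply {n : ℕ} (x : L) (ω : L [⋀^Fin (n + 1)]→ₗ[R] M) (v : Fin n → L) :
    contract x ω v = ω (Matrix.vecCons x v) := rfl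

theorem ext_contract {n : ℕ} {ω η : L [⋀^Fin (n + 1)]→ₗ[R] M}
    (h : ∀ x, contract x ω = contract x η) : ω = η := by
  ext v
  have := congrArg (fun f => f (Matrix.vecTail v)) (h (Matrix.vecHead v))
  simpa only [contract_apply, Matrix.cons_head_tail] using this

theorem contract_add {n : ℕ} (x y : L) (ω : L [⋀^Fin (n + 1)]→ₗ[R] M) :
    contract (x + y) ω = contract x ω + contract y ω := by
  simp [contract]

theorem contract_smul {n : ℕ} (c : R) (x : L) (ω : L [⋀^Fin (n + 1)]→ₗ[R] M) :
    contract (c • x) ω = c • contract x ω := by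
  simp [contract]

theorem contract_sub {n : ℕ} (x y : L) (ω : L [⋀^Fin (n + 1)]→ₗ[R] M) :
    contract (x - y) ω = contract x ω - contract y ω := by
  simp [contract]

end Contraction

section Coboundary

variable {R L M : Type*} [CommRing R] [LieRing L] [LieAlgebra R L]
  [AddCommGroup M] [Module R M] [LieRingModule L M]

/-- The value of the Chevalley–Eilenberg coboundary of `ω` at `v = (v_0, …, v_n)`:
`∑ j, (-1)^j v_j · ω(v_0, …, v̂_j, …, v_n)
  + ∑ i < j, (-1)^j ω(v_0, …, v_{i-1}, [v_i, v_j], v_{i+1}, …, v̂_j, …, v_n)`.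
The bracket stands at place `i`; moving it to the front gives the usual sign `(-1)^(i+j)`
(see `coboundaryFun_succ`). -/
def coboundaryFun {n : ℕ} (ω : L [⋀^Fin n]→ₗ[R] M) (v : Fin (n + 1) → L) : M :=
  (∑ j : Fin (n + 1), (-1 : ℤ) ^ (j : ℕ) • ⁅v j, ω (j.removeNth v)⁆) +
    ∑ j : Fin (n + 1), ∑ i : Fin n, if i.castSucc < j then
      (-1 : ℤ) ^ (j : ℕ) • ω (Function.update (j.removeNth v) i ⁅v i.castSucc, v j⁆) else 0

/-- The coboundary in the usual form, with `[v_i, v_j]` in the first place: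
the pair `i ≤ j` of indices below stands for the pair `i < j + 1` of places. -/
theorem coboundaryFun_succ {n : ℕ} (ω : L [⋀^Fin (n + 1)]→ₗ[R] M) (v : Fin (n + 2) → L) :
    coboundaryFun ω v =
      (∑ j : Fin (n + 2), (-1 : ℤ) ^ (j : ℕ) • ⁅v j, ω (j.removeNth v)⁆) +
      ∑ i : Fin (n + 1), ∑ j : Fin (n + 1), if i ≤ j then
        (-1 : ℤ) ^ ((i.castSucc : ℕ) + (j.succ : ℕ)) •
          ω (Matrix.vecCons ⁅v i.castSucc, v j.succ⁆ (i.removeNth (j.succ.removeNth v)))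
      else 0 := by
  rw [coboundaryFun]
  congr 1
  rw [Fin.sum_univ_succ, Finset.sum_comm]
  simp only [Fin.not_lt_zero, if_false, Finset.sum_const_zero, zero_add,
    Fin.castSucc_lt_succ_iff]
  refine Finset.sum_congr rfl fun i _ => Finset.sum_congr rfl fun j _ => ?_
  split_ifs with h
  · rw [← Fin.insertNth_removeNth, AlternatingMap.map_insertNth, smul_smul, ← pow_add,
      add_comm (j.succ : ℕ)]
    rfl
  · rfl

theorem coboundaryFun_zero (ω : L [⋀^Fin 0]→ₗ[R] M) (v : Fin 1 → L) :
    coboundaryFun ω v = ⁅v 0, ω ![]⁆ := by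
  simp [coboundaryFun, Subsingleton.elim (Fin.removeNth 0 v) ![]]

theorem coboundaryFun_add {n : ℕ} (ω η : L [⋀^Fin n]→ₗ[R] M) (v : Fin (n + 1) → L) :
    coboundaryFun (ω + η) v = coboundaryFun ω v + coboundaryFun η v := by
  have : ∀ (p : Prop) [Decidable p] (a b : M),
      (if p then a + b else 0) = (if p then a else 0) + (if p then b else 0) := by
    intro p _ a b; split_ifs <;> simp
  simp only [coboundaryFun, AlternatingMap.add_apply, lie_add, smul_add, this,
    Finset.sum_add_distrib]
  abel

variable [LieModule R L M]

theorem coboundaryFun_smul {n : ℕ} (c : R) (ω : L [⋀^Fin n]→ₗ[R] M) (v : Fin (n + 1) → L) :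
    coboundaryFun (c • ω) v = c • coboundaryFun ω v := by
  simp only [coboundaryFun, AlternatingMap.smul_apply, lie_smul, smul_add, Finset.smul_sum,
    smul_ite, smul_zero, smul_comm c]

theorem lieDerAux {n : ℕ} (x : L) (ω : L [⋀^Fin n]→ₗ[R] M) (v : Fin n → L) :
    ((LieModule.toEnd R L M x).compMultilinearMap ω.toMultilinearMap -
        ∑ k, ω.toMultilinearMap.compLinearMap
          (Function.update (fun _ => LinearMap.id) k (LieAlgebra.ad R L x))) v =
      ⁅x, ω v⁆ - ∑ k, ω (Function.update v k ⁅x, v k⁆) := by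
  have h : ∀ k : Fin n, (fun i => (Function.update (fun _ => (LinearMap.id : L →ₗ[R] L)) k
      (LieAlgebra.ad R L x) : Fin n → (L →ₗ[R] L)) i (v i)) =
      Function.update v k ⁅x, v k⁆ := by
    intro k
    ext i
    rcases eq_or_ne i k with rfl | hik
    · simp
    · simp [hik]
  simp only [sub_apply, sum_apply,
    MultilinearMap.compLinearMap_apply, h]
  rfl

/-- The action of `x` on cochains,
`(θ_x ω)(v) = x · ω(v) - ∑ k, ω(v_0, …, [x, v_k], …, v_{n-1})`. -/
def lieDer {n : ℕ} (x : L) : (L [⋀^Fin n]→ₗ[R] M) →ₗ[R] (L [⋀^Fin n]→ₗ[R] M) where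
  toFun ω :=
    { (LieModule.toEnd R L M x).compMultilinearMap ω.toMultilinearMap -
        ∑ k, ω.toMultilinearMap.compLinearMap
          (Function.update (fun _ => LinearMap.id) k (LieAlgebra.ad R L x)) with
      map_eq_zero_of_eq' := by
        intro v i j hv hij
        have h := lieDerAux x ω v
        simp only [MultilinearMap.toFun_eq_coe] at h ⊢
        rw [h, ω.map_eq_zero_of_eq v hv hij, lie_zero, zero_sub, neg_eq_zero,
          Fintype.sum_eq_add i j hij]
        · have hsw : Function.update v j ⁅x, v j⁆ =
              Function.update v i ⁅x, v i⁆ ∘ Equiv.swap i j := by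
            ext k
            rcases eq_or_ne k i with rfl | hki
            · simp [hij, hij.symm, hv]
            · rcases eq_or_ne k j with rfl | hkj
              · simp [hv]
              · simp [Equiv.swap_apply_of_ne_of_ne, hki, hkj]
          rw [hsw, ω.map_swap _ hij, add_neg_cancel]
        · rintro k ⟨hki, hkj⟩
          exact ω.map_eq_zero_of_eq _ (by simp [hki.symm, hkj.symm, hv]) hij }
  map_add' := by
    intro ω η
    ext v
    refine (lieDerAux x (ω + η) v).trans ?_
    refine Eq.trans ?_ (congrArg₂ (· + ·) (lieDerAux x ω v) (lieDerAux x η v)).symm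
    simp [Finset.sum_add_distrib]
    abel
  map_smul' := by
    intro c ω
    ext v
    refine (lieDerAux x (c • ω) v).trans ?_
    refine Eq.trans ?_ (congrArg (c • ·) (lieDerAux x ω v)).symm
    simp [Finset.smul_sum, smul_sub]

theorem lieDer_apply {n : ℕ} (x : L) (ω : L [⋀^Fin n]→ₗ[R] M) (v : Fin n → L) :
    lieDer x ω v = ⁅x, ω v⁆ - ∑ k, ω (Function.update v k ⁅x, v k⁆) :=
  lieDerAux x ω v

theorem contract_lieDer {n : ℕ} (x y : L) (ω : L [⋀^Fin (n + 1)]→ₗ[R] M) :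
    contract y (lieDer x ω) = lieDer x (contract y ω) - contract ⁅x, y⁆ ω := by
  ext v
  simp only [contract_apply, lieDer_apply, AlternatingMap.sub_apply, Fin.sum_univ_succ]
  have h0 : Function.update (Matrix.vecCons y v) 0 ⁅x, y⁆ = Matrix.vecCons ⁅x, y⁆ v := by
    simp [Matrix.vecCons]
  have hs : ∀ k : Fin n, Function.update (Matrix.vecCons y v) k.succ ⁅x, v k⁆ =
      Matrix.vecCons y (Function.update v k ⁅x, v k⁆) := by
    intro k
    simp [Matrix.vecCons, Fin.cons_update]
  simp only [Matrix.cons_val_zero, Matrix.cons_val_succ, h0, hs]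
  abel

/-- Cartan's formula. -/
theorem coboundaryFun_cons {n : ℕ} (ω : L [⋀^Fin (n + 1)]→ₗ[R] M) (x : L)
    (v : Fin (n + 1) → L) :
    coboundaryFun ω (Matrix.vecCons x v) =
      lieDer x ω v - coboundaryFun (contract x ω) v := by
  have hr : ∀ j : Fin (n + 1), Fin.removeNth j.succ (Matrix.vecCons x v) =
      Matrix.vecCons x (j.removeNth v) := by
    intro j
    ext k
    refine Fin.cases ?_ (fun k => ?_) k <;> simp [Fin.removeNth, Matrix.vecCons]
  have hu0 : ∀ (y : L) (w : Fin n → L), Function.update (Matrix.vecCons x w) 0 y =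
      Matrix.vecCons y w := by
    intro y w; simp [Matrix.vecCons]
  have hus : ∀ (y : L) (w : Fin n → L) (k : Fin n),
      Function.update (Matrix.vecCons x w) k.succ y =
      Matrix.vecCons x (Function.update w k y) := by
    intro y w k; simp [Matrix.vecCons, Fin.cons_update]
  have hm : ∀ k : Fin (n + 1), ω (Function.update v k ⁅x, v k⁆) =
      (-1 : ℤ) ^ (k : ℕ) • ω (Matrix.vecCons ⁅x, v k⁆ (k.removeNth v)) := by
    intro k
    rw [← Fin.insertNth_removeNth, AlternatingMap.map_insertNth]
  have h0 : Fin.removeNth 0 (Matrix.vecCons x v) = v := by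
    ext k; simp [Fin.removeNth]
  have h1 : (∑ j : Fin (n + 2), (-1 : ℤ) ^ (j : ℕ) •
        ⁅Matrix.vecCons x v j, ω (j.removeNth (Matrix.vecCons x v))⁆) =
      ⁅x, ω v⁆ - ∑ j : Fin (n + 1), (-1 : ℤ) ^ (j : ℕ) • ⁅v j, contract x ω (j.removeNth v)⁆ := by
    rw [Fin.sum_univ_succ]
    simp only [hr, h0, contract_apply, Matrix.cons_val_zero, Matrix.cons_val_succ, Fin.val_succ,
      Fin.val_zero, pow_zero, one_smul, pow_succ, mul_neg_one, neg_smul, Finset.sum_neg_distrib,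
      sub_eq_add_neg]
  have h2 : (∑ j : Fin (n + 2), ∑ i : Fin (n + 1), if i.castSucc < j then
        (-1 : ℤ) ^ (j : ℕ) • ω (Function.update (j.removeNth (Matrix.vecCons x v)) i
          ⁅Matrix.vecCons x v i.castSucc, Matrix.vecCons x v j⁆) else 0) =
      - (∑ k, ω (Function.update v k ⁅x, v k⁆)) -
      ∑ j : Fin (n + 1), ∑ i : Fin n, if i.castSucc < j then
        (-1 : ℤ) ^ (j : ℕ) • contract x ω
          (Function.update (j.removeNth v) i ⁅v i.castSucc, v j⁆) else 0 := by
    rw [Fin.sum_univ_succ]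
    simp only [Fin.not_lt_zero, if_false, Finset.sum_const_zero, zero_add]
    rw [← Finset.sum_neg_distrib, ← Finset.sum_sub_distrib]
    refine Finset.sum_congr rfl fun j _ => ?_
    rw [Fin.sum_univ_succ, hr, hm, sub_eq_add_neg, ← Finset.sum_neg_distrib]
    congr 1
    · simp [hu0, pow_succ]
    · refine Finset.sum_congr rfl fun i _ => ?_
      simp only [Fin.castSucc_succ, Fin.succ_lt_succ_iff, hus, Matrix.cons_val_succ,
        contract_apply, Fin.val_succ, pow_succ, mul_neg_one, neg_smul]
      split_ifs <;> simp
  rw [coboundaryFun, h1, h2, coboundaryFun, lieDer_apply]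
  abel

theorem lieDer_add {n : ℕ} (x y : L) (ω : L [⋀^Fin n]→ₗ[R] M) :
    lieDer (x + y) ω = lieDer x ω + lieDer y ω := by
  ext v
  simp only [lieDer_apply, AlternatingMap.add_apply, add_lie, AlternatingMap.map_update_add,
    Finset.sum_add_distrib]
  abel

theorem lieDer_smul {n : ℕ} (c : R) (x : L) (ω : L [⋀^Fin n]→ₗ[R] M) :
    lieDer (c • x) ω = c • lieDer x ω := by
  ext v
  simp only [lieDer_apply, AlternatingMap.smul_apply, smul_lie, AlternatingMap.map_update_smul,
    Finset.smul_sum, smul_sub]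

/-- The function `coboundaryFun ω` is multilinear and alternating. -/
theorem exists_coboundary {n : ℕ} (ω : L [⋀^Fin n]→ₗ[R] M) :
    ∃ T : L [⋀^Fin (n + 1)]→ₗ[R] M, ∀ v, T v = coboundaryFun ω v := by
  induction n with
  | zero =>
    let f : L →ₗ[R] M :=
      { toFun := fun x => ⁅x, ω ![]⁆
        map_add' := fun x y => add_lie x y _
        map_smul' := fun c x => smul_lie c x _ }
    refine ⟨AlternatingMap.ofSubsingleton R L M (0 : Fin 1) f, fun v => ?_⟩
    rw [coboundaryFun_zero]
    rfl
  | succ n ih =>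
    choose T hT using ih
    let g : L →ₗ[R] (L [⋀^Fin (n + 1)]→ₗ[R] M) :=
      { toFun := fun x => lieDer x ω - T (contract x ω)
        map_add' := by
          intro x y
          ext v
          simp only [AlternatingMap.sub_apply, AlternatingMap.add_apply, hT, lieDer_add,
            contract_add, coboundaryFun_add]
          abel
        map_smul' := by
          intro c x
          ext v
          simp only [AlternatingMap.sub_apply, AlternatingMap.smul_apply, hT, lieDer_smul,
            contract_smul, coboundaryFun_smul, RingHom.id_apply, smul_sub] }
    let G : MultilinearMap R (fun _ : Fin (n + 2) => L) M :=
      LinearMap.uncurryLeft (AlternatingMap.toMultilinearMapLM ∘ₗ g)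
    have hG : ∀ x v, G (Matrix.vecCons x v) = g x v := by
      intro x v
      simp [G, LinearMap.uncurryLeft_apply]
    have hGc : ∀ v, G v = coboundaryFun ω v := by
      intro v
      rw [← Matrix.cons_head_tail v, hG, coboundaryFun_cons, ← hT]
      rfl
    have hzero : ∀ (x : L) (w : Fin n → L),
        G (Matrix.vecCons x (Matrix.vecCons x w)) = 0 := by
      intro x w
      have h1 : lieDer x ω (Matrix.vecCons x w) = lieDer x (contract x ω) w := by
        have h0 : contract (0 : L) ω = 0 := by simp [contract]
        have h := congrArg (fun f => f w) (contract_lieDer x x ω)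
        rwa [lie_self, h0, sub_zero] at h
      rw [hGc, coboundaryFun_cons, h1, sub_eq_zero]
      cases n with
      | zero =>
        rw [coboundaryFun_zero, lieDer_apply, Subsingleton.elim w ![]]
        simp
      | succ m =>
        have h2 : contract x (contract x ω) = 0 := AlternatingMap.curryLeft_same ω x
        have h3 : coboundaryFun (0 : L [⋀^Fin m]→ₗ[R] M) w = 0 := by
          simpa using coboundaryFun_smul (0 : R) (0 : L [⋀^Fin m]→ₗ[R] M) w
        rw [coboundaryFun_cons, h2, h3, sub_zero]
    have hkey' : ∀ (x : L) (t : Fin (n + 1) → L), x = t 0 → g x t = 0 := by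
      intro x t ht
      rw [← hG, ← Matrix.cons_head_tail t, ht]
      exact hzero _ _
    have hkey : ∀ (v : Fin (n + 2) → L) (j : Fin (n + 1)), v 0 = v j.succ → G v = 0 := by
      intro v j hv
      rw [← Matrix.cons_head_tail v, hG]
      rcases eq_or_ne j 0 with rfl | hj
      · exact hkey' _ _ hv
      · rw [← neg_eq_zero, ← (g _).map_swap _ hj.symm]
        refine hkey' _ _ ?_
        rw [Function.comp_apply, Equiv.swap_apply_left]
        exact hv
    refine ⟨{ G with map_eq_zero_of_eq' := ?_ }, hGc⟩
    intro v i j hv hij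
    change G v = 0
    induction i using Fin.cases with
    | zero =>
      obtain ⟨j, rfl⟩ := Fin.exists_succ_eq.2 hij.symm
      exact hkey v j hv
    | succ i =>
      induction j using Fin.cases with
      | zero => exact hkey v i hv.symm
      | succ j =>
        rw [← Matrix.cons_head_tail v, hG]
        exact (g _).map_eq_zero_of_eq _ hv (fun h => hij (congrArg _ h))

/-- The coboundary operator of the Chevalley–Eilenberg complex. -/
def coboundary (R L M : Type*) [CommRing R] [LieRing L] [LieAlgebra R L]
    [AddCommGroup M] [Module R M] [LieRingModule L M] [LieModule R L M] (n : ℕ) :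
    (L [⋀^Fin n]→ₗ[R] M) →ₗ[R] (L [⋀^Fin (n + 1)]→ₗ[R] M) where
  toFun ω :=
    { toFun := coboundaryFun ω
      map_update_add' := by
        intro inst v i x y
        obtain ⟨T, hT⟩ := exists_coboundary ω
        simp only [← hT, T.map_update_add]
      map_update_smul' := by
        intro inst v i c x
        obtain ⟨T, hT⟩ := exists_coboundary ω
        simp only [← hT, T.map_update_smul]
      map_eq_zero_of_eq' := by
        intro v i j hv hij
        obtain ⟨T, hT⟩ := exists_coboundary ω
        rw [← hT, T.map_eq_zero_of_eq v hv hij] }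
  map_add' ω η := AlternatingMap.ext fun v => coboundaryFun_add ω η v
  map_smul' c ω := AlternatingMap.ext fun v => coboundaryFun_smul c ω v

theorem coboundary_apply {n : ℕ} (ω : L [⋀^Fin n]→ₗ[R] M) (v : Fin (n + 1) → L) :
    coboundary R L M n ω v = coboundaryFun ω v := rfl

theorem contract_coboundary {n : ℕ} (x : L) (ω : L [⋀^Fin (n + 1)]→ₗ[R] M) :
    contract x (coboundary R L M (n + 1) ω) =
      lieDer x ω - coboundary R L M n (contract x ω) :=
  AlternatingMap.ext fun v => coboundaryFun_cons ω x v

theorem contract_coboundary_zero (x : L) (ω : L [⋀^Fin 0]→ₗ[R] M) :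
    contract x (coboundary R L M 0 ω) = lieDer x ω := by
  ext v
  rw [contract_apply, coboundary_apply, coboundaryFun_zero, lieDer_apply,
    Subsingleton.elim v ![]]
  simp

theorem lieDer_lie {n : ℕ} (x y : L) (ω : L [⋀^Fin n]→ₗ[R] M) :
    lieDer ⁅x, y⁆ ω = lieDer x (lieDer y ω) - lieDer y (lieDer x ω) := by
  induction n with
  | zero =>
    ext v
    simp [lieDer_apply]
  | succ n ih =>
    refine ext_contract fun z => ?_
    simp only [map_sub, contract_lieDer, ih, lie_lie, contract_sub]
    abel

theorem coboundary_lieDer {n : ℕ} (x : L) (ω : L [⋀^Fin n]→ₗ[R] M) :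
    coboundary R L M n (lieDer x ω) = lieDer x (coboundary R L M n ω) := by
  induction n with
  | zero =>
    refine ext_contract fun y => ?_
    rw [contract_lieDer, contract_coboundary_zero, contract_coboundary_zero,
      contract_coboundary_zero, lieDer_lie]
    abel
  | succ n ih =>
    refine ext_contract fun y => ?_
    rw [contract_lieDer, contract_coboundary, contract_coboundary, contract_coboundary,
      lieDer_lie, contract_lieDer, map_sub, map_sub, ih]
    abel

theorem coboundary_coboundary {n : ℕ} (ω : L [⋀^Fin n]→ₗ[R] M) :
    coboundary R L M (n + 1) (coboundary R L M n ω) = 0 := by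
  induction n with
  | zero =>
    refine ext_contract fun x => ?_
    rw [contract_coboundary, contract_coboundary_zero, coboundary_lieDer, sub_self, map_zero]
  | succ n ih =>
    refine ext_contract fun x => ?_
    rw [contract_coboundary, contract_coboundary, map_sub, ih, sub_zero, coboundary_lieDer,
      sub_self, map_zero]

end Coboundary

section Cohomology

variable (R L M : Type*) [CommRing R] [LieRing L] [LieAlgebra R L]
  [AddCommGroup M] [Module R M] [LieRingModule L M] [LieModule R L M]

/-- The `n`-cocycles of `L` with values in `M`. -/
def cocycles (n : ℕ) : Submodule R (L [⋀^Fin n]→ₗ[R] M) :=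
  LinearMap.ker (coboundary R L M n)

/-- The `n`-coboundaries of `L` with values in `M`. -/
def coboundaries : (n : ℕ) → Submodule R (L [⋀^Fin n]→ₗ[R] M)
  | 0 => ⊥
  | n + 1 => LinearMap.range (coboundary R L M n)

theorem coboundaries_le_cocycles (n : ℕ) : coboundaries R L M n ≤ cocycles R L M n := by
  cases n with
  | zero => exact bot_le
  | succ n =>
    rintro _ ⟨ω, rfl⟩
    exact coboundary_coboundary ω

/-- The cohomology `H^n(L, M)`: cocycles modulo coboundaries. -/
abbrev cohomology (n : ℕ) : Type _ :=
  cocycles R L M n ⧸ (coboundaries R L M n).submoduleOf (cocycles R L M n)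

end Cohomology

end ChevalleyEilenberg

/-! It suffices to find a nonzero `L`-equivariant endomorphism `T` of `S` that sends cocycles to
coboundaries: by Schur's lemma `T` is bijective, its inverse is again equivariant, and so every
cocycle is itself a coboundary. The centre decides where `T` comes from.

If there is a central `z ≠ 0`, let `T` be the action of `z`. It is nonzero by faithfulness, and on
cochains it equals `θ_z`, because `[z, ·] = 0`; Cartan's formula `θ_z = d ι_z + ι_z d` makes it
null-homotopic.

If the centre is zero, the trace form of `S` is nondegenerate. Its radical is an ideal, abelian by
Cartan's criterion, and an abelian ideal is central here (`LieIdeal.le_center_of_isIrreducible`).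
Take for `T` the Casimir operator `∑ b_i c_i` of dual bases: its trace is `dim L ≠ 0`, and `∑ b_i ·
ι_{c_i}` is a contracting homotopy for it on cocycles. -/

/-- In characteristic zero, an endomorphism all of whose positive powers have trace zero is
nilpotent. -/
theorem Module.End.isNilpotent_of_forall_trace_pow_succ_eq_zero {K V : Type*} [Field K]
    [CharZero K] [AddCommGroup V] [Module K V] [FiniteDimensional K V] (f : Module.End K V)
    (h : ∀ k, LinearMap.trace K V (f ^ (k + 1)) = 0) : IsNilpotent f := by
  have hm : minpoly K f ≠ 0 := minpoly.ne_zero (Algebra.IsIntegral.isIntegral f)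
  obtain ⟨q, hq, hXq⟩ := Polynomial.exists_eq_pow_rootMultiplicity_mul_and_not_dvd _ hm 0
  rw [Polynomial.C_0, sub_zero] at hq hXq
  set k := (minpoly K f).rootMultiplicity 0
  -- The exponent `k + 1`, not `k`, leaves `a * X ^ (k + 1)` without constant term even when `k =
  -- 0`, so only traces of positive powers of `f` occur.
  have hcop : IsCoprime (Polynomial.X ^ (k + 1)) q :=
    ((Polynomial.irreducible_X.coprime_iff_not_dvd).2 hXq).pow_left
  obtain ⟨a, b, hab⟩ := hcop
  have hann : Polynomial.aeval f (Polynomial.X ^ k * q) = 0 := by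
    rw [← hq, minpoly.aeval]
  have htr : ∀ p : Polynomial K,
      LinearMap.trace K V (Polynomial.aeval f (p * Polynomial.X ^ (k + 1))) = 0 := by
    intro p
    induction p using Polynomial.induction_on' with
    | add p q hp hq => rw [add_mul, map_add, map_add, hp, hq, add_zero]
    | monomial n c =>
      rw [Polynomial.monomial_mul_X_pow, Polynomial.aeval_monomial, ← Algebra.smul_def,
        map_smul, ← add_assoc, h, smul_zero]
  -- This is the Fitting projection onto the part where `f` is invertible. In characteristic zero an
  -- idempotent of trace zero vanishes.
  have hidem : IsIdempotentElem (Polynomial.aeval f (a * Polynomial.X ^ (k + 1))) := by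
    rw [IsIdempotentElem, ← map_mul, ← sub_eq_zero, ← map_sub,
      show a * Polynomial.X ^ (k + 1) * (a * Polynomial.X ^ (k + 1)) -
        a * Polynomial.X ^ (k + 1) = -(a * b * Polynomial.X) * (Polynomial.X ^ k * q) by
        linear_combination (a * Polynomial.X ^ (k + 1)) * hab, map_mul, hann, mul_zero]
  have he := LinearMap.IsIdempotentElem.eq_zero_of_trace_eq_zero hidem (htr a)
  refine ⟨k, ?_⟩
  have h1 : f ^ k = Polynomial.aeval f (Polynomial.X ^ k : Polynomial K) := by simp
  rw [h1, show (Polynomial.X ^ k : Polynomial K) =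
      (Polynomial.X : Polynomial K) ^ k * (a * Polynomial.X ^ (k + 1)) + b * (Polynomial.X ^ k * q) by
        linear_combination (-(Polynomial.X : Polynomial K) ^ k) * hab,
    map_add, map_mul _ (_ ^ k), he, map_mul _ b, hann, mul_zero, mul_zero, add_zero]

/-! ### Ideals and the trace form on a faithful irreducible module -/

section Faithful

variable {F L S : Type*} [Field F] [LieRing L] [LieAlgebra F L]
  [AddCommGroup S] [Module F S] [LieRingModule L S] [LieModule F L S]

/-- An ideal acting nilpotently on a faithful irreducible module vanishes. -/
theorem LieIdeal.eq_bot_of_isNilpotent_of_isIrreducible [LieModule.IsFaithful F L S]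
    [LieModule.IsIrreducible F L S] (J : LieIdeal F L) [LieModule.IsNilpotent J S] : J = ⊥ := by
  have := LieModule.nontrivial_of_isIrreducible F L S
  -- The vectors killed by `J` are stable under all of `L` because `J` is an ideal. Nilpotency makes
  -- this submodule nonzero, hence everything, so faithfulness forces `J = ⊥`.
  let N : LieSubmodule F L S :=
    { LieModule.maxTrivSubmodule F J S with
      lie_mem := by
        intro y m hm
        have hm' : ∀ x : J, ⁅(x : L), m⁆ = 0 := hm
        change ∀ x : J, ⁅(x : L), ⁅y, m⁆⁆ = 0
        intro x
        rw [leibniz_lie, hm' x, lie_zero, add_zero]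
        exact hm' ⟨⁅(x : L), y⁆, lie_mem_left F L J x y x.2⟩ }
  have hN : N = ⊤ := by
    refine (eq_bot_or_eq_top N).resolve_left fun h => ?_
    have := LieModule.nontrivial_max_triv_of_isNilpotent F J S
    obtain ⟨m, hm⟩ := exists_ne (0 : LieModule.maxTrivSubmodule F J S)
    have : (m : S) ∈ N := m.2
    rw [h, LieSubmodule.mem_bot] at this
    exact hm (Subtype.ext this)
  rw [LieSubmodule.eq_bot_iff]
  intro x hx
  rw [← LieModule.toEnd_eq_zero_iff (R := F) (L := L) (M := S)]
  ext m
  have : m ∈ N := hN ▸ LieSubmodule.mem_top m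
  exact this ⟨x, hx⟩

/-- Engel's theorem for `J` acting on `S`. -/
theorem LieIdeal.isNilpotent_of_forall_isNilpotent_toEnd [FiniteDimensional F S]
    (J : LieIdeal F L)
    (h : ∀ x ∈ J, IsNilpotent (LieModule.toEnd F L S x)) : LieModule.IsNilpotent J S :=
  (LieModule.isNilpotent_iff_forall' (R := F)).2 fun x => h x x.2

variable [CharZero F] [FiniteDimensional F S]
  [LieModule.IsFaithful F L S] [LieModule.IsIrreducible F L S]

/-- An ideal on which the trace form of a faithful irreducible module vanishes is abelian. -/
theorem LieIdeal.lie_eq_zero_of_traceForm_eq_zero (I : LieIdeal F L)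
    (h : ∀ x ∈ I, ∀ y ∈ I, LieModule.traceForm F L S x y = 0) :
    ∀ x ∈ I, ∀ y ∈ I, ⁅x, y⁆ = 0 := by
  have h0 : LieModule.traceForm F I S = 0 := by
    ext x y
    exact h x x.2 y y.2
  -- Cartan's criterion for `I` as a Lie algebra in its own right. Its derived algebra is then
  -- identified with `⁅I, I⁆` taken in `L`, which is an ideal of `L`.
  have hn := LieModule.isNilpotent_derivedSeries_of_traceForm_eq_zero h0
  rw [LieModule.isNilpotent_iff_forall' (R := F)] at hn
  have hJ : LieModule.IsNilpotent (⁅I, I⁆ : LieIdeal F L) S := by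
    refine LieIdeal.isNilpotent_of_forall_isNilpotent_toEnd _ fun x hx => ?_
    refine hn ⟨⟨x, LieSubmodule.lie_le_left I I hx⟩, ?_⟩
    rw [LieIdeal.derivedSeries_eq_derivedSeriesOfIdeal_comap, LieIdeal.mem_comap]
    exact hx
  have hb := LieIdeal.eq_bot_of_isNilpotent_of_isIrreducible (F := F) (S := S) ⁅I, I⁆
  intro x hx y hy
  have := LieSubmodule.lie_mem_lie hx hy
  rwa [hb, LieSubmodule.mem_bot] at this

/-- An abelian ideal of a Lie algebra with a faithful irreducible module is central. -/
theorem LieIdeal.le_center_of_isIrreducible {F L : Type*} (S : Type*) [Field F] [CharZero F]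
    [LieRing L] [LieAlgebra F L] [AddCommGroup S] [Module F S] [LieRingModule L S]
    [LieModule F L S] [FiniteDimensional F S]
    [LieModule.IsFaithful F L S] [LieModule.IsIrreducible F L S] (I : LieIdeal F L)
    (h : ∀ x ∈ I, ∀ y ∈ I, ⁅x, y⁆ = 0) : I ≤ LieAlgebra.center F L := by
  have hmul : ∀ x y : L, LieModule.toEnd F L S ⁅x, y⁆ =
      LieModule.toEnd F L S x * LieModule.toEnd F L S y -
        LieModule.toEnd F L S y * LieModule.toEnd F L S x := fun x y => by
    ext m
    exact lie_lie x y m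
  have hcomm : ∀ x ∈ I, ∀ y ∈ I,
      Commute (LieModule.toEnd F L S x) (LieModule.toEnd F L S y) := by
    intro x hx y hy
    rw [commute_iff_eq, ← sub_eq_zero, ← hmul, h x hx y hy, map_zero]
  -- For `z = [y, x]` with `x ∈ I`, cyclicity gives `tr([y, x] C) = tr(y (x C - C x)) = 0`.
  have htr : ∀ z ∈ (⁅(⊤ : LieIdeal F L), I⁆ : LieIdeal F L), ∀ C : Module.End F S,
      (∀ x ∈ I, Commute C (LieModule.toEnd F L S x)) →
      LinearMap.trace F S (LieModule.toEnd F L S z * C) = 0 := by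
    intro z hz C hC
    rw [← LieSubmodule.mem_toSubmodule, LieSubmodule.lieIdeal_oper_eq_linear_span'] at hz
    induction hz using Submodule.span_induction with
    | zero => simp
    | add u v _ _ hu hv => rw [map_add, add_mul, map_add, hu, hv, add_zero]
    | smul t u _ hu => rw [map_smul, smul_mul_assoc, map_smul, hu, smul_zero]
    | mem u hu =>
      obtain ⟨y, -, x, hx, rfl⟩ := hu
      rw [hmul, sub_mul, map_sub, mul_assoc, mul_assoc,
        LinearMap.trace_mul_comm _ (LieModule.toEnd F L S x), mul_assoc, (hC x hx).eq, sub_self]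
  have hJ : LieModule.IsNilpotent (⁅(⊤ : LieIdeal F L), I⁆ : LieIdeal F L) S := by
    refine LieIdeal.isNilpotent_of_forall_isNilpotent_toEnd _ fun z hz => ?_
    refine Module.End.isNilpotent_of_forall_trace_pow_succ_eq_zero _ fun k => ?_
    rw [pow_succ']
    -- Take `C = z ^ k`, which commutes with `I` since `z ∈ [L, I] ⊆ I` and `I` is abelian.
    exact htr z hz _ fun x hx => (hcomm z (LieSubmodule.lie_le_right _ _ hz) x hx).pow_left k
  have hb := LieIdeal.eq_bot_of_isNilpotent_of_isIrreducible (F := F) (S := S)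
    ⁅(⊤ : LieIdeal F L), I⁆
  intro x hx
  rw [LieModule.mem_maxTrivSubmodule]
  intro y
  have := LieSubmodule.lie_mem_lie (LieSubmodule.mem_top y) hx
  rwa [hb, LieSubmodule.mem_bot] at this

/-- The trace form of a faithful irreducible module is nondegenerate if the centre is trivial. -/
theorem LieModule.traceForm_nondegenerate_of_center_eq_bot (hc : LieAlgebra.center F L = ⊥) :
    (LieModule.traceForm F L S).Nondegenerate := by
  let I := LieAlgebra.InvariantForm.orthogonal (LieModule.traceForm F L S)
    (LieModule.traceForm_lieInvariant F L S) ⊤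
  have hI : ∀ x, x ∈ I ↔ ∀ y, LieModule.traceForm F L S y x = 0 := by
    intro x
    simp [I, LieAlgebra.InvariantForm.mem_orthogonal]
  have h0 : I = ⊥ := by
    rw [eq_bot_iff, ← hc]
    refine LieIdeal.le_center_of_isIrreducible S I ?_
    exact LieIdeal.lie_eq_zero_of_traceForm_eq_zero (S := S) I fun x _ y hy => (hI y).1 hy x
  refine (LieModule.traceForm_isSymm F L S).isRefl.nondegenerate_iff_separatingLeft.mpr ?_
  intro x hx
  have : x ∈ I := (hI x).2 fun y => (LieModule.traceForm_comm F L S y x).trans (hx y)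
  rwa [h0, LieSubmodule.mem_bot] at this

end Faithful

/-! ### Null-homotopic operators on cochains -/

namespace ChevalleyEilenberg

section Homotopy

variable {R L M : Type*} [CommRing R] [LieRing L] [LieAlgebra R L]
  [AddCommGroup M] [Module R M] [LieRingModule L M] [LieModule R L M]

theorem coboundary_compAlternatingMap {N : Type*} [AddCommGroup N] [Module R N]
    [LieRingModule L N] [LieModule R L N] (T : M →ₗ⁅R, L⁆ N) {n : ℕ} (ω : L [⋀^Fin n]→ₗ[R] M) :
    coboundary R L N n ((T : M →ₗ[R] N).compAlternatingMap ω) =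
      (T : M →ₗ[R] N).compAlternatingMap (coboundary R L M n ω) := by
  ext v
  simp only [coboundary_apply, coboundaryFun, LinearMap.compAlternatingMap_apply, map_add,
    map_sum, map_zsmul, LieModuleHom.coe_toLinearMap, LieModuleHom.map_lie, apply_ite T, map_zero]

/-- The cohomology vanishes if an equivariant automorphism of the coefficients sends all
cocycles to coboundaries. -/
theorem subsingleton_cohomology_of_bijective (T : M →ₗ⁅R, L⁆ M) (hT : Function.Bijective T)
    (n : ℕ) (h : ∀ ω ∈ cocycles R L M n,
      (T : M →ₗ[R] M).compAlternatingMap ω ∈ coboundaries R L M n) :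
    Subsingleton (cohomology R L M n) := by
  rw [cohomology, Submodule.Quotient.subsingleton_iff, Submodule.submoduleOf_eq_top]
  intro ω hω
  cases n with
  | zero =>
    -- In degree zero the only coboundary is `0`, so injectivity of `T` is enough.
    have h0 : (T : M →ₗ[R] M).compAlternatingMap ω = 0 := h ω hω
    change ω = 0
    ext v
    exact hT.1 ((congrArg (fun f => f v) h0).trans (map_zero T).symm)
  | succ n =>
    obtain ⟨η, hη⟩ := h ω hω
    obtain ⟨g, hgT, hTg⟩ := Function.bijective_iff_has_inverse.1 hT
    refine ⟨((T.inverse g hgT hTg : M →ₗ⁅R, L⁆ M) : M →ₗ[R] M).compAlternatingMap η, ?_⟩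
    rw [coboundary_compAlternatingMap, hη]
    ext v
    exact hgT (ω v)

/-- A central element acts on cohomology by zero. -/
theorem compAlternatingMap_toEnd_mem_coboundaries {z : L} (hz : z ∈ LieAlgebra.center R L)
    (n : ℕ) {ω : L [⋀^Fin n]→ₗ[R] M} (hω : ω ∈ cocycles R L M n) :
    (LieModule.toEnd R L M z).compAlternatingMap ω ∈ coboundaries R L M n := by
  have hz' : ∀ y : L, ⁅z, y⁆ = 0 := by
    intro y
    rw [← lie_skew, (LieModule.mem_maxTrivSubmodule R L L z).1 hz, neg_zero]
  have h1 : (LieModule.toEnd R L M z).compAlternatingMap ω = lieDer z ω := by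
    ext v
    have : ∀ k, ω (Function.update v k 0) = 0 := fun k => ω.map_update_zero v k
    simp [lieDer_apply, hz', this]
  have hω' : coboundary R L M n ω = 0 := hω
  rw [h1]
  cases n with
  | zero =>
    rw [← contract_coboundary_zero, hω', map_zero]
    exact Submodule.zero_mem _
  | succ n =>
    refine ⟨contract z ω, ?_⟩
    have h := contract_coboundary z ω
    rw [hω', map_zero] at h
    exact (sub_eq_zero.1 h.symm).symm

/-- The failure of the coboundary to commute with the action of `x` on the coefficients. -/
theorem coboundary_compAlternatingMap_toEnd {n : ℕ} (x : L) (ω : L [⋀^Fin n]→ₗ[R] M)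
    (v : Fin (n + 1) → L) :
    coboundary R L M n ((LieModule.toEnd R L M x).compAlternatingMap ω) v =
      ⁅x, coboundary R L M n ω v⁆ +
        ∑ j : Fin (n + 1), (-1 : ℤ) ^ (j : ℕ) • ⁅⁅v j, x⁆, ω (j.removeNth v)⁆ := by
  simp only [coboundary_apply, coboundaryFun, LinearMap.compAlternatingMap_apply,
    LieModule.toEnd_apply_apply, lie_add, lie_sum, lie_zsmul, leibniz_lie (v _) x, smul_add,
    Finset.sum_add_distrib, apply_ite (fun m : M => ⁅x, m⁆), lie_zero]
  abel

/-- Two families `b` and `c` in a Lie algebra with `∑ i, b i ⊗ c i` invariant, as seen by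
bilinear maps to `M`. -/
def IsInvariantPair {ι : Type*} [Fintype ι] (R M : Type*) {L : Type*} [CommRing R] [LieRing L]
    [LieAlgebra R L] [AddCommGroup M] [Module R M] (b c : ι → L) : Prop :=
  ∀ (y : L) (f : L →ₗ[R] L →ₗ[R] M), ∑ i, (f ⁅y, b i⁆ (c i) + f (b i) ⁅y, c i⁆) = 0

variable {ι : Type*} [Fintype ι] {b c : ι → L}

/-- The Casimir operator `∑ i, b i * c i` of an invariant pair. -/
def casimir (h : IsInvariantPair R M b c) : M →ₗ⁅R, L⁆ M where
  toLinearMap := ∑ i, LieModule.toEnd R L M (b i) * LieModule.toEnd R L M (c i)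
  map_lie' := by
    intro y m
    have hf := h y (LinearMap.mk₂ R (fun a d => ⁅a, ⁅d, m⁆⁆) (by simp) (by simp) (by simp)
      (by simp))
    simp only [LinearMap.mk₂_apply] at hf
    change (∑ i, LieModule.toEnd R L M (b i) * LieModule.toEnd R L M (c i)) ⁅y, m⁆ =
      ⁅y, (∑ i, LieModule.toEnd R L M (b i) * LieModule.toEnd R L M (c i)) m⁆
    simp only [LinearMap.sum_apply, Module.End.mul_apply, LieModule.toEnd_apply_apply, lie_sum]
    rw [← zero_add (∑ i, ⁅b i, ⁅c i, ⁅y, m⁆⁆⁆), ← hf, ← Finset.sum_add_distrib]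
    refine Finset.sum_congr rfl fun i _ => ?_
    rw [leibniz_lie y (b i), leibniz_lie y (c i), lie_add, add_assoc]

theorem casimir_apply (h : IsInvariantPair R M b c) (m : M) :
    casimir h m = ∑ i, ⁅b i, ⁅c i, m⁆⁆ := by
  change (∑ i, LieModule.toEnd R L M (b i) * LieModule.toEnd R L M (c i)) m = _
  simp

theorem casimir_toLinearMap (h : IsInvariantPair R M b c) :
    (casimir h : M →ₗ[R] M) =
      ∑ i, LieModule.toEnd R L M (b i) * LieModule.toEnd R L M (c i) := rfl

/-- The Casimir operator acts on cohomology by zero. -/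
theorem compAlternatingMap_casimir_mem_coboundaries (h : IsInvariantPair R M b c)
    (n : ℕ) {ω : L [⋀^Fin n]→ₗ[R] M} (hω : ω ∈ cocycles R L M n) :
    (casimir h : M →ₗ[R] M).compAlternatingMap ω ∈ coboundaries R L M n := by
  have hω' : coboundary R L M n ω = 0 := hω
  cases n with
  | zero =>
    change _ = _
    ext v
    have hc : ∀ x : L, ⁅x, ω v⁆ = 0 := by
      intro x
      have h0 := congrArg (fun f => f v) (contract_coboundary_zero x ω)
      rw [hω', map_zero] at h0
      simpa [lieDer_apply] using h0.symm
    change casimir h (ω v) = 0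
    simp [casimir_apply, hc]
  | succ n =>
    have hc : ∀ x, coboundary R L M n (contract x ω) = lieDer x ω := by
      intro x
      have h0 := contract_coboundary x ω
      rw [hω', map_zero] at h0
      exact (sub_eq_zero.1 h0.symm).symm
    -- The sign `(-1) ^ k` moves `x` from the front to place `k`, matching the error terms of
    -- `coboundary_compAlternatingMap_toEnd` with the terms of `lieDer`.
    have hm : ∀ (v : Fin (n + 1) → L) (x : L) (k : Fin (n + 1)),
        (-1 : ℤ) ^ (k : ℕ) • contract x ω (k.removeNth v) = ω (Function.update v k x) := by
      intro v x k
      rw [← Fin.insertNth_removeNth, AlternatingMap.map_insertNth]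
      rfl
    -- The coboundary of this cochain is `∑ b_i · θ_{c_i} ω` plus the terms `[v_j, b_i] · ω(…, c_i,
    -- …)` with `c_i` at place `j`. The part `∑ b_i · c_i · ω(v)` is the Casimir operator; the rest
    -- must cancel.
    refine ⟨∑ i, (LieModule.toEnd R L M (b i)).compAlternatingMap (contract (c i) ω), ?_⟩
    ext v
    -- For each place `j`, invariance under `v j` is tested on `(a, d) ↦ a · ω(v with d at place
    -- j)`.
    have hf : ∀ j, ∑ i, (⁅⁅v j, b i⁆, ω (Function.update v j (c i))⁆ +
        ⁅b i, ω (Function.update v j ⁅v j, c i⁆)⁆) = 0 := fun j =>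
      h (v j) (LinearMap.mk₂ R (fun a d => ⁅a, ω (Function.update v j d)⁆) (by simp) (by simp)
        (by simp) (by simp))
    have hneg : ∀ i j, ω (Function.update v j ⁅v j, c i⁆) =
        - ω (Function.update v j ⁅c i, v j⁆) := by
      intro i j
      rw [← lie_skew, AlternatingMap.map_update_neg]
    have hsum : ∑ i, ∑ j, (⁅⁅v j, b i⁆, ω (Function.update v j (c i))⁆ -
        ⁅b i, ω (Function.update v j ⁅c i, v j⁆)⁆) = 0 := by
      rw [Finset.sum_comm]
      refine Finset.sum_eq_zero fun j _ => ?_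
      simpa only [hneg, lie_neg, ← sub_eq_add_neg] using hf j
    have hs : ∀ g : ι → L [⋀^Fin (n + 1)]→ₗ[R] M, (∑ i, g i) v = ∑ i, g i v := fun g =>
      map_sum (AddMonoidHom.mk' (fun f : L [⋀^Fin (n + 1)]→ₗ[R] M => f v) fun _ _ => rfl) g _
    rw [map_sum, hs]
    simp only [coboundary_compAlternatingMap_toEnd, hc, lieDer_apply, ← lie_zsmul, hm, lie_sub,
      lie_sum]
    change _ = casimir h (ω v)
    rw [casimir_apply]
    refine Eq.trans ?_ (add_zero _)
    rw [← hsum, ← Finset.sum_add_distrib]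
    refine Finset.sum_congr rfl fun i _ => ?_
    rw [Finset.sum_sub_distrib]
    abel

end Homotopy

/-! ### Dual bases of an invariant form -/

section DualBasis

variable {F L S : Type*} [Field F] [LieRing L] [LieAlgebra F L]
  [AddCommGroup S] [Module F S] {ι : Type*} [Fintype ι] [DecidableEq ι]

/-- Expand `[y, b_i]` in `b` and `[y, c_i]` in `c`. Invariance of `B` makes the two coefficient
matrices negative transposes of each other, so the sums cancel after exchanging indices. -/
theorem isInvariantPair_dualBasis (B : LinearMap.BilinForm F L) (hB : B.Nondegenerate)
    (hs : B.IsSymm) (hi : B.lieInvariant L) (b : Module.Basis ι F L) :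
    IsInvariantPair F S b (B.dualBasis hB b) := by
  intro y f
  set c := B.dualBasis hB b with hc
  have h1 : ∀ x, x = ∑ j, B x (c j) • b j := by
    intro x
    conv_lhs => rw [← b.sum_repr x]
    refine Finset.sum_congr rfl fun j _ => ?_
    -- By symmetry `b` is the dual basis of `c`, so its coordinates are the pairings with the `c j`.
    conv_rhs => rw [← LinearMap.BilinForm.dualBasis_dualBasis hB hs b]
    rw [← LinearMap.BilinForm.dualBasis_repr_apply hB, ← hc,
      LinearMap.BilinForm.dualBasis_dualBasis hB hs b]
  have h2 : ∀ x, x = ∑ j, B x (b j) • c j := by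
    intro x
    conv_lhs => rw [← c.sum_repr x]
    simp only [hc, LinearMap.BilinForm.dualBasis_repr_apply]
  have e1 : ∑ i, f ⁅y, b i⁆ (c i) = ∑ i, ∑ j, B ⁅y, b i⁆ (c j) • f (b j) (c i) := by
    refine Finset.sum_congr rfl fun i _ => ?_
    conv_lhs => rw [h1 ⁅y, b i⁆]
    simp
  have e2 : ∑ i, f (b i) ⁅y, c i⁆ = ∑ i, ∑ j, B ⁅y, c i⁆ (b j) • f (b i) (c j) := by
    refine Finset.sum_congr rfl fun i _ => ?_
    conv_lhs => rw [h2 ⁅y, c i⁆]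
    simp
  rw [Finset.sum_add_distrib, e1, e2, Finset.sum_comm, ← Finset.sum_add_distrib]
  refine Finset.sum_eq_zero fun i _ => ?_
  rw [← Finset.sum_add_distrib]
  refine Finset.sum_eq_zero fun j _ => ?_
  rw [← add_smul, hi y (b j) (c i), hs.eq (b j), neg_add_cancel, zero_smul]

end DualBasis

end ChevalleyEilenberg

/-! ### Schur's lemma and the vanishing theorem -/

/-- Schur's lemma. -/
theorem LieModuleHom.bijective_of_isIrreducible {F L S : Type*} [Field F] [LieRing L]
    [LieAlgebra F L] [AddCommGroup S] [Module F S] [LieRingModule L S] [LieModule F L S]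
    [LieModule.IsIrreducible F L S] (T : S →ₗ⁅F, L⁆ S) (hT : T ≠ 0) : Function.Bijective T := by
  constructor
  · rw [← LieModuleHom.ker_eq_bot]
    refine (eq_bot_or_eq_top T.ker).resolve_right fun h => hT ?_
    ext m
    exact (LieModuleHom.mem_ker).1 (h ▸ LieSubmodule.mem_top m)
  · rw [← LieModuleHom.range_eq_top]
    refine (eq_bot_or_eq_top T.range).resolve_left fun h => hT ?_
    ext m
    have : T m ∈ T.range := (LieModuleHom.mem_range T _).2 ⟨m, rfl⟩
    rwa [h, LieSubmodule.mem_bot] at this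

theorem theorem3p1 {F L S : Type*} [Field F] [CharZero F]
    [LieRing L] [LieAlgebra F L] [FiniteDimensional F L] [Nontrivial L]
    [AddCommGroup S] [Module F S] [LieRingModule L S] [LieModule F L S]
    [FiniteDimensional F S] [LieModule.IsFaithful F L S] [LieModule.IsIrreducible F L S]
    (n : ℕ) :
    Subsingleton (ChevalleyEilenberg.cohomology F L S n) := by
  by_cases hc : LieAlgebra.center F L = ⊥
  · have hB := LieModule.traceForm_nondegenerate_of_center_eq_bot (S := S) hc
    have hs : LinearMap.BilinForm.IsSymm (LieModule.traceForm F L S) :=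
      ⟨fun x y => LieModule.traceForm_comm F L S x y⟩
    let b := Module.finBasis F L
    have hp := ChevalleyEilenberg.isInvariantPair_dualBasis (S := S) _ hB hs
      (LieModule.traceForm_lieInvariant F L S) b
    refine ChevalleyEilenberg.subsingleton_cohomology_of_bijective (ChevalleyEilenberg.casimir hp)
      (LieModuleHom.bijective_of_isIrreducible _ fun h0 => ?_) n fun ω hω =>
        ChevalleyEilenberg.compAlternatingMap_casimir_mem_coboundaries hp n hω
    -- Each summand is `tr(b_i c_i)`, the trace form of a dual pair, hence `1`. The total `dim L` is
    -- nonzero in `F` since `L ≠ 0` and the characteristic is zero.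
    have htr : LinearMap.trace F S (ChevalleyEilenberg.casimir hp : S →ₗ[F] S) =
        Module.finrank F L := by
      rw [ChevalleyEilenberg.casimir_toLinearMap, map_sum]
      refine (Finset.sum_congr rfl fun i _ =>
        (LinearMap.BilinForm.apply_dualBasis_right hB hs b i i).trans (if_pos rfl)).trans ?_
      simp
    rw [h0, show ((0 : S →ₗ⁅F, L⁆ S) : S →ₗ[F] S) = 0 from rfl, map_zero, eq_comm,
      Nat.cast_eq_zero] at htr
    exact Module.finrank_pos.ne' htr
  · obtain ⟨z, hz, hz0⟩ := Submodule.exists_mem_ne_zero_of_ne_bot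
      (mt (LieSubmodule.toSubmodule_eq_bot _).1 hc)
    -- The action of a central element commutes with `L`; it is nonzero because `S` is faithful and
    -- `z ≠ 0`.
    let T : S →ₗ⁅F, L⁆ S :=
      { LieModule.toEnd F L S z with
        map_lie' := by
          intro y m
          change ⁅z, ⁅y, m⁆⁆ = ⁅y, ⁅z, m⁆⁆
          rw [leibniz_lie y z, (LieModule.mem_maxTrivSubmodule F L L z).1 hz, zero_lie, zero_add] }
    refine ChevalleyEilenberg.subsingleton_cohomology_of_bijective T
      (LieModuleHom.bijective_of_isIrreducible _ fun h0 => hz0 ?_) n fun ω hω =>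
        ChevalleyEilenberg.compAlternatingMap_toEnd_mem_coboundaries hz n hω
    rw [← LieModule.toEnd_eq_zero_iff (R := F) (L := L) (M := S)]
    ext m
    exact LieModuleHom.congr_fun h0 m
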